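/- A finite simplicial complex is a finite family of finite sets (faces), closed under taking subsets and containing $\emptyset$. For a complex $K$ and a face $\sigma$, $\mathrm{link}_K(\sigma)=\{\tau\in K:\sigma\cap\tau=\emptyset,\ \sigma\cup\tau\in K\}$. If $n=\dim K+1$ is the maximal size of a face and $f_{l-1}$ is the number of faces of size $l$, the $h$-polynomial of $K$ is $h(K,t)=\sum_{m=0}^{n}h_mt^m$ with $h_m=\sum_{l=0}^{m}(-1)^{m-l}\binom{n-l}{m-l}f_{l-1}$. Let $L$ be the triangulation of the $j$-simplex with one interior vertex obtained by starring, i.e. the stellar subdivision of the $j$-simplex at its top face: its vertices are the $j+1$ vertices of the simplex and one further vertex $v$, and its faces are all sets of these vertices that do not contain all $j+1$ vertices of the simplex. Let $\diamondsuit(d)$ be the boundary complex of the $d$-dimensional cross-polytope. A complex $K'$ is a generalized Tchebyshev triangulation of $\diamondsuit(d)$ induced by $L$, written $\diamondsuit(d,L)$, if there are a list $\sigma_1,\dots,\sigma_m$ of the $j$-dimensional faces of $\diamondsuit(d)$, each listed exactly once, and complexes $K_0=\diamondsuit(d),K_1,\dots,K_m=K'$ such that, for every $a\ge 1$, $K_a$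 is obtained from $K_{a-1}$ by replacing the face $\sigma_a$ with an isomorphic copy $L_a$ of $L$ (the vertices of the simplex corresponding to those of $\sigma_a$ and the interior vertex to a new vertex) and the faces $\sigma_a\cup\tau$, $\tau\in\mathrm{link}_{K_{a-1}}(\sigma_a)$, with the faces $\sigma'\cup\tau$, $\sigma'\in L_a$, $\tau\in\mathrm{link}_{K_{a-1}}(\sigma_a)$. For $i\ge 1$ let $P_{0,i}(t)=1$ and, for $d\geq 1$, let $P_{d,i}(t)=(1+t+\dots+t^i)^q(1+t+\dots+t^r)$, where $q\ge0$ and $1\le r\le i$ are the unique integers with $d=qi+r$. Let $g^{(i)}(\diamondsuit(d,L))$ be the vector of coefficients of $h(\diamondsuit(d,L),t)$ with respect to the linearly independent polynomials $t^lP_{d-2l,i}(t)$, $0\le l\le\lfloor d/2\rfloor$. **Statement.** Let $d\ge1$ and $1\le j\le i$ be integers, and let $L$ be the starred $j$-simplex. Then for every generalized Tchebyshev triangulation $\diamondsuit(d,L)$ of $\diamondsuit(d)$ induced by $L$, the vector $g^{(i)}(\diamondsuit(d,L))$ is well defined (the $h$-polynomial has a unique expansion in these polynomials, with integer coefficients),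 and all its entries are nonnegative. -/

import Mathlib

open Polynomial

/-- A finite (abstract) simplicial complex with vertices in `V`: a finite family of finite sets,
closed under taking subsets. The empty set is always a face. The vertices of the complex are those
`v : V` for which `{v}` is a face; `V` itself is only an ambient set of names and may be larger. -/
@[ext]
structure SimplComplex (V : Type*) where
  /-- the faces -/
  faces : Finset (Finset V)
  empty_mem : ∅ ∈ faces
  down_closed : ∀ F ∈ faces, ∀ G, G ⊆ F → G ∈ faces

namespace SimplComplex

/-- `v` is a vertex of `K`. -/
def IsVertex {V : Type*} (K : SimplComplex V) (v : V) : Prop := {v} ∈ K.faces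

/-- `τ` belongs to the link of `σ` in `K`. -/
def InLink {V : Type*} [DecidableEq V] (K : SimplComplex V) (σ τ : Finset V) : Prop :=
  τ ∈ K.faces ∧ Disjoint σ τ ∧ σ ∪ τ ∈ K.faces

/-- The simplex on the vertex set `S`, with all its faces. -/
def simplex {V : Type*} (S : Finset V) : SimplComplex V where
  faces := S.powerset
  empty_mem := by simp
  down_closed := fun F hF G hG =>
    Finset.mem_powerset.2 (hG.trans (Finset.mem_powerset.1 hF))

/-- The image of a complex under a renaming of its vertices. -/
def map {V W : Type*} [DecidableEq W] (e : V ↪ W) (K : SimplComplex V) : SimplComplex W where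
  faces := K.faces.image (fun F => F.map e)
  empty_mem := Finset.mem_image.2 ⟨∅, K.empty_mem, by simp⟩
  down_closed := by
    intro F hF G hG
    obtain ⟨F', hF', rfl⟩ := Finset.mem_image.1 hF
    obtain ⟨G', hG', rfl⟩ := Finset.subset_map_iff.1 hG
    exact Finset.mem_image.2 ⟨G', K.down_closed _ hF' _ hG', rfl⟩

open Classical in
/-- The stellar subdivision of `K` at the nonempty set `F`, with new vertex `v`:
the faces of `K` not containing `F`, together with the join of `{v}`, the boundary complex of `F`
and the link of `F` in `K`. It is meant for `F` a face of `K` and `v` not a vertex of `K`. -/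
noncomputable def stellar {V : Type*} [DecidableEq V] (K : SimplComplex V) (F : Finset V)
    (hF : F.Nonempty) (v : V) : SimplComplex V where
  faces := K.faces.filter (fun T => ¬ F ⊆ T) ∪
    (({v} : Finset V).powerset ×ˢ (F.ssubsets ×ˢ K.faces.filter (fun τ => K.InLink F τ))).image
      (fun p => p.1 ∪ (p.2.1 ∪ p.2.2))
  empty_mem := by
    refine Finset.mem_union_left _ (Finset.mem_filter.2 ⟨K.empty_mem, fun h => ?_⟩)
    exact hF.ne_empty (Finset.subset_empty.1 h)
  down_closed := by
    intro T hT G hG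
    rcases Finset.mem_union.1 hT with hT | hT
    · obtain ⟨hT, hFT⟩ := Finset.mem_filter.1 hT
      exact Finset.mem_union_left _
        (Finset.mem_filter.2 ⟨K.down_closed _ hT _ hG, fun h => hFT (h.trans hG)⟩)
    · obtain ⟨⟨A, ρ, τ⟩, hp, rfl⟩ := Finset.mem_image.1 hT
      simp only [Finset.mem_product, Finset.mem_powerset, Finset.mem_ssubsets,
        Finset.mem_filter] at hp
      obtain ⟨hA, hρ, hτ, -, hd, hu⟩ := hp
      refine Finset.mem_union_right _ (Finset.mem_image.2 ⟨(G ∩ A, G ∩ ρ, G ∩ τ), ?_, ?_⟩)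
      · simp only [Finset.mem_product, Finset.mem_powerset, Finset.mem_ssubsets,
          Finset.mem_filter]
        have hτ' : G ∩ τ ∈ K.faces := K.down_closed _ hτ _ Finset.inter_subset_right
        refine ⟨Finset.inter_subset_right.trans hA,
          lt_of_le_of_lt Finset.inter_subset_right hρ, hτ', hτ', ?_, ?_⟩
        · exact hd.mono_right Finset.inter_subset_right
        · exact K.down_closed _ hu _ (Finset.union_subset_union_right Finset.inter_subset_right)
      · simp only
        rw [← Finset.inter_union_distrib_left, ← Finset.inter_union_distrib_left]
        exact Finset.inter_eq_left.2 hG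

/-- The number of faces with exactly `m` vertices, i.e. `f_{m-1}(K)`. -/
def fNum {V : Type*} (K : SimplComplex V) (m : ℕ) : ℕ :=
  (K.faces.filter (fun F => F.card = m)).card

/-- `dim K + 1`, the largest number of vertices of a face. -/
def dimSucc {V : Type*} (K : SimplComplex V) : ℕ := K.faces.sup Finset.card

/-- The entry `h_m(K) = ∑_{l ≤ m} (-1)^{m-l} C(n-l, m-l) f_{l-1}(K)` of the `h`-vector,
where `n = dim K + 1`. -/
def hNum {V : Type*} (K : SimplComplex V) (m : ℕ) : ℤ :=
  ∑ l ∈ Finset.range (m + 1),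
    (-1 : ℤ) ^ (m - l) * (Nat.choose (K.dimSucc - l) (m - l) : ℤ) * (K.fNum l : ℤ)

/-- The `h`-polynomial of `K`. -/
noncomputable def hPoly {V : Type*} (K : SimplComplex V) : ℤ[X] :=
  ∑ m ∈ Finset.range (K.dimSucc + 1), C (K.hNum m) * X ^ m

/-- The boundary complex of the `d`-dimensional cross-polytope: its vertices are
`(a, true)`, `(a, false)` for `a : Fin d`, and its faces are the sets of vertices containing no
antipodal pair `(a, true)`, `(a, false)`. -/
def crossPolytope (d : ℕ) : SimplComplex (Fin d × Bool) where
  faces := Finset.univ.filter (fun F => ∀ a : Fin d, ¬ ((a, true) ∈ F ∧ (a, false) ∈ F))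
  empty_mem := by simp
  down_closed := by
    intro F hF G hG
    simp only [Finset.mem_filter, Finset.mem_univ, true_and] at hF ⊢
    exact fun a h => hF a ⟨hG h.1, hG h.2⟩

/-- The vertices of the original `j`-simplex inside `starredSimplex j`. -/
def starredBoundary (j : ℕ) : Finset (Option (Fin (j + 1))) :=
  Finset.univ.map Function.Embedding.some

theorem starredBoundary_nonempty (j : ℕ) : (starredBoundary j).Nonempty :=
  Finset.univ_nonempty.map

/-- The triangulation of the `j`-simplex with one interior vertex obtained by starring: the stellar
subdivision of the `j`-simplex (with vertices `some a`) at its top face, the new vertex being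
`none`. -/
noncomputable def starredSimplex (j : ℕ) : SimplComplex (Option (Fin (j + 1))) :=
  stellar (simplex (starredBoundary j)) (starredBoundary j) (starredBoundary_nonempty j) none

/-- Let `L` triangulate a simplex, with `B` the set of vertices of that simplex, the other vertices
of `L` being interior. `K'` is obtained from `K` by replacing `σ` with an isomorphic copy of `L`
(through the vertex map `φ`, which takes `B` onto `σ` and the interior vertices of `L` to new
vertices), and the faces `σ ∪ τ`, `τ` in the link of `σ`, with the faces `σ' ∪ τ`, where `σ'` runs
over the copy of `L`. -/
def IsReplacement {V W : Type*} [DecidableEq V] (L : SimplComplex W) (B : Finset W)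
    (σ : Finset V) (K K' : SimplComplex V) : Prop :=
  ∃ φ : W → V,
    Set.InjOn φ {w | L.IsVertex w} ∧
    B.image φ = σ ∧
    (∀ w, L.IsVertex w → w ∉ B → ¬ K.IsVertex (φ w)) ∧
    ∀ T : Finset V, T ∈ K'.faces ↔
      (T ∈ K.faces ∧ ¬ σ ⊆ T) ∨
      ∃ ρ ∈ L.faces, ∃ τ, K.InLink σ τ ∧ T = ρ.image φ ∪ τ

/-- `K'` is a generalized Tchebyshev triangulation of `K` induced by the triangulation `L` of the
`k`-simplex, where `B` is the set of original vertices of that simplex: the `k`-dimensional faces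
of `K` are listed, each exactly once, as `σ 0, …, σ (m-1)`, and are replaced by copies of `L` in
this order. -/
def IsGenTchebyshev {V W : Type*} [DecidableEq V] (k : ℕ) (L : SimplComplex W) (B : Finset W)
    (K K' : SimplComplex V) : Prop :=
  ∃ (m : ℕ) (σ : Fin m → Finset V) (Ks : Fin (m + 1) → SimplComplex V),
    Function.Injective σ ∧
    (∀ F : Finset V, (∃ a, σ a = F) ↔ F ∈ K.faces ∧ F.card = k + 1) ∧
    Ks 0 = K ∧ Ks (Fin.last m) = K' ∧
    ∀ a : Fin m, IsReplacement L B (σ a) (Ks a.castSucc) (Ks a.succ)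

end SimplComplex

/-- `P_{d,i}(t) = (1 + t + ⋯ + t^i)^q (1 + t + ⋯ + t^r)`, where `d = q i + r` with `q ≥ 0` and
`1 ≤ r ≤ i` (for `d, i ≥ 1`), and `P_{0,i} = 1`. -/
noncomputable def gBasisP (d i : ℕ) : ℤ[X] :=
  if d = 0 then 1
  else (∑ a ∈ Finset.range (i + 1), X ^ a) ^ ((d - 1) / i) *
    ∑ a ∈ Finset.range ((d - 1) % i + 1 + 1), X ^ a

/-- `g` is the vector `g^{(d,i)}(p)` of coefficients of the polynomial `p` in the basis
`t^l P_{d-2l,i}(t)`, `0 ≤ l ≤ ⌊d/2⌋`. -/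
def IsGVector (d i : ℕ) (p : ℤ[X]) (g : Fin (d / 2 + 1) → ℤ) : Prop :=
  p = ∑ l : Fin (d / 2 + 1), C (g l) * (X ^ (l : ℕ) * gBasisP (d - 2 * (l : ℕ)) i)

/-! Write [n] = 1 + t + ⋯ + t^(n-1). Replacing a face F by a starred simplex is stellar subdivision
at F with a new vertex v. The argument follows the `h`-polynomials of the links of all ρ, written
h_ρ (`linkH`), instead of that of the complex alone. When ρ neither contains v nor includes F, a
subdivision changes h_ρ to h_ρ + t [|F \ ρ| - 1] h_{ρ ∪ F} (`IsStellar.linkH_eq`), so nothing is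
ever subtracted.

It remains to see that nonnegativity in the basis t^l P_{n-2l,i} survives such a step. The cone
`gCone i n` of nonnegative combinations is stable under multiplication by [a+1] with a ≤ i, at the
cost of raising n by a (`geomPoly_mul_mem_gCone`); this rests on an exchange identity for [m][n].
Since |F| = j + 1 ≤ i + 1, the factors that occur are short enough, and the degrees match.

In the cross-polytope the links have h_ρ = (1+t)^(d-|ρ|), which lies in the cone. Induction over the
subdivisions, restricted to ρ made of original vertices, ends at ρ = ∅, where h_ρ is the
`h`-polynomial. Uniqueness of the expansion is triangularity. -/

/-! ### Geometric sums and the basis polynomials. -/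

/-- The polynomial `1 + t + ⋯ + t^(n-1)`. -/
noncomputable def geomPoly (n : ℕ) : ℤ[X] := ∑ a ∈ Finset.range n, X ^ a

@[simp] theorem geomPoly_zero : geomPoly 0 = 0 := by simp [geomPoly]

@[simp] theorem geomPoly_one : geomPoly 1 = 1 := by simp [geomPoly]

theorem geomPoly_mul (n : ℕ) : geomPoly n * (1 - X) = 1 - X ^ n := geom_sum_mul_neg X n

theorem one_sub_X_ne_zero : (1 - X : ℤ[X]) ≠ 0 := by
  intro h
  simpa using congrArg (eval 0) h

/-- Clearing (1 - X)² makes both sides elementary. The identity trades two factors for a longer and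
a shorter one, with a remainder that has positive coefficients. -/
theorem geomPoly_mul_geomPoly (c u w : ℕ) :
    geomPoly (c + w + 1) * geomPoly (c + u + 1) =
      geomPoly (c + w + u + 1) * geomPoly (c + 1) + X ^ (c + 1) * (geomPoly u * geomPoly w) := by
  apply mul_right_cancel₀ (mul_ne_zero one_sub_X_ne_zero one_sub_X_ne_zero)
  calc _ = (geomPoly (c + w + 1) * (1 - X)) * (geomPoly (c + u + 1) * (1 - X)) := by ring
    _ = (geomPoly (c + w + u + 1) * (1 - X)) * (geomPoly (c + 1) * (1 - X)) +
        X ^ (c + 1) * ((geomPoly u * (1 - X)) * (geomPoly w * (1 - X))) := by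
      simp only [geomPoly_mul]
      ring
    _ = _ := by ring

/-- Both ends r = 0 and r = i are allowed, since [1] = 1 and a full block may be counted either way.
Hence ordinary division with remainder can be used, though the definition takes remainders in 1, …,
i. -/
theorem gBasisP_mul_add {i r : ℕ} (hi : 1 ≤ i) (hr : r ≤ i) (q : ℕ) :
    gBasisP (q * i + r) i = geomPoly (i + 1) ^ q * geomPoly (r + 1) := by
  unfold gBasisP
  rcases Nat.eq_zero_or_pos r with rfl | hr0
  · rcases q with _ | q
    · simp
    · have h0 : (q + 1) * i + 0 ≠ 0 := by positivity
      have h1 : (q + 1) * i + 0 - 1 = (i - 1) + i * q := by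
        rw [Nat.add_mul, Nat.mul_comm q i]; omega
      rw [if_neg h0, h1, Nat.add_mul_div_left _ _ (by omega), Nat.add_mul_mod_self_left,
        Nat.div_eq_of_lt (by omega), Nat.mod_eq_of_lt (by omega), Nat.sub_add_cancel hi]
      simp [geomPoly, pow_succ]
  · have h0 : q * i + r ≠ 0 := by omega
    have h1 : q * i + r - 1 = (r - 1) + i * q := by
      rw [Nat.mul_comm q i]; omega
    rw [if_neg h0, h1, Nat.add_mul_div_left _ _ (by omega), Nat.add_mul_mod_self_left,
      Nat.div_eq_of_lt (by omega), Nat.mod_eq_of_lt (by omega), Nat.sub_add_cancel hr0]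
    simp [geomPoly]

theorem gBasisP_coeff_zero (d i : ℕ) : (gBasisP d i).coeff 0 = 1 := by
  unfold gBasisP
  split_ifs
  · simp
  · rw [coeff_zero_eq_eval_zero, eval_mul, eval_pow, eval_finsetSum, eval_finsetSum,
      Finset.sum_range_succ', Finset.sum_range_succ']
    simp

/-! ### The cone and its stability under short geometric factors. -/

/-- The cone of nonnegative integer combinations of the polynomials `t^l P_{n-2l,i}(t)`. -/
noncomputable def gCone (i n : ℕ) : AddSubmonoid ℤ[X] :=
  AddSubmonoid.closure {p | ∃ l m, 2 * l + m = n ∧ p = X ^ l * gBasisP m i}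

theorem X_pow_mul_gBasisP_mem_gCone (i l m : ℕ) :
    X ^ l * gBasisP m i ∈ gCone i (2 * l + m) :=
  AddSubmonoid.subset_closure ⟨l, m, rfl, rfl⟩

theorem X_pow_mul_mem_gCone {i n : ℕ} {p : ℤ[X]} (l : ℕ) (hp : p ∈ gCone i n) :
    X ^ l * p ∈ gCone i (2 * l + n) := by
  induction hp using AddSubmonoid.closure_induction with
  | mem p hp =>
    obtain ⟨k, m, rfl, rfl⟩ := hp
    rw [← mul_assoc, ← pow_add, ← add_assoc, ← mul_add]
    exact X_pow_mul_gBasisP_mem_gCone i (l + k) m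
  | zero => simp
  | add p q _ _ hp hq => rw [mul_add]; exact add_mem hp hq

theorem geomPoly_pow_mul_mem_gCone_of_add_le {i a r : ℕ} (hi : 1 ≤ i) (har : a + r ≤ i) (q : ℕ) :
    geomPoly (i + 1) ^ q * (geomPoly (a + 1) * geomPoly (r + 1)) ∈ gCone i (q * i + (a + r)) := by
  induction a generalizing r with
  | zero =>
    have := X_pow_mul_gBasisP_mem_gCone i 0 (q * i + r)
    rw [gBasisP_mul_add hi (by omega)] at this
    simpa using this
  | succ a ih =>
    -- With c = 0 the short factor is 1, so the main term is a single basis element; the remainder X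
    -- [r] [a+1] is a smaller instance.
    have key := geomPoly_mul_geomPoly 0 r (a + 1)
    simp only [zero_add, geomPoly_one, mul_one, pow_one] at key
    rw [key, mul_add]
    refine add_mem ?_ ?_
    · have := X_pow_mul_gBasisP_mem_gCone i 0 (q * i + (a + 1 + r))
      rw [gBasisP_mul_add hi har] at this
      simpa using this
    · rcases r with _ | r
      · simp
      · have := X_pow_mul_mem_gCone 1 (ih (r := r) (by omega))
        convert this using 1
        · congr 1; omega
        · ring

theorem geomPoly_pow_mul_mem_gCone {i a r : ℕ} (hi : 1 ≤ i) (ha : a ≤ i) (hr : r ≤ i) (q : ℕ) :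
    geomPoly (i + 1) ^ q * (geomPoly (a + 1) * geomPoly (r + 1)) ∈ gCone i (q * i + (a + r)) := by
  rcases le_total (a + r) i with h | h
  · exact geomPoly_pow_mul_mem_gCone_of_add_le hi h q
  -- The overflow c = a + r - i is chosen so that the exchange creates a full factor [i+1]; the
  -- remainder X^(c+1) [u] [w] has u + w ≤ i and falls under the previous case.
  obtain ⟨c, hc⟩ := Nat.exists_eq_add_of_le h
  obtain ⟨w, rfl⟩ : ∃ w, a = c + w := Nat.exists_eq_add_of_le (by omega)
  obtain ⟨u, rfl⟩ : ∃ u, r = c + u := Nat.exists_eq_add_of_le (by omega)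
  obtain rfl : i = c + w + u := by omega
  rw [geomPoly_mul_geomPoly, mul_add (geomPoly _ ^ q)]
  refine add_mem ?_ ?_
  · have := X_pow_mul_gBasisP_mem_gCone (c + w + u) 0 ((q + 1) * (c + w + u) + c)
    rw [gBasisP_mul_add hi (by omega)] at this
    convert this using 1
    · congr 1; ring
    · ring
  · rcases u with _ | u
    · simp
    rcases w with _ | w
    · simp
    have := X_pow_mul_mem_gCone (c + 1)
      (geomPoly_pow_mul_mem_gCone_of_add_le hi (a := u) (r := w) (by omega) q)
    convert this using 1
    · congr 1; ring
    · ring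

theorem geomPoly_mul_mem_gCone {i a n : ℕ} (hi : 1 ≤ i) (ha : a ≤ i) {p : ℤ[X]}
    (hp : p ∈ gCone i n) : geomPoly (a + 1) * p ∈ gCone i (a + n) := by
  induction hp using AddSubmonoid.closure_induction with
  | mem p hp =>
    obtain ⟨l, m, rfl, rfl⟩ := hp
    have hm : m / i * i + m % i = m := Nat.div_add_mod' m i
    have hr : m % i ≤ i := (Nat.mod_lt _ hi).le
    have := X_pow_mul_mem_gCone l (geomPoly_pow_mul_mem_gCone hi ha hr (m / i))
    rw [← hm, gBasisP_mul_add hi hr]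
    convert this using 1
    · congr 1; omega
    · ring
  | zero => simp
  | add p q _ _ hp hq => rw [mul_add]; exact add_mem hp hq

theorem one_mem_gCone (i : ℕ) : 1 ∈ gCone i 0 := by
  simpa [gBasisP] using X_pow_mul_gBasisP_mem_gCone i 0 0

theorem one_add_X_pow_mem_gCone {i : ℕ} (hi : 1 ≤ i) (n : ℕ) : (1 + X) ^ n ∈ gCone i n := by
  induction n with
  | zero => simpa using one_mem_gCone i
  | succ n ih =>
    -- The second `hi` is the bound a ≤ i for a = 1, the factor being [2] = 1 + X.
    have := geomPoly_mul_mem_gCone hi hi ih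
    rw [add_comm 1 n] at this
    convert this using 1
    rw [pow_succ, mul_comm]
    simp [geomPoly, Finset.sum_range_succ]

/-! ### Existence and uniqueness of the coefficient vector. -/

theorem exists_nonneg_isGVector {i d : ℕ} {p : ℤ[X]} (hp : p ∈ gCone i d) :
    ∃ g, IsGVector d i p g ∧ ∀ l, 0 ≤ g l := by
  induction hp using AddSubmonoid.closure_induction with
  | mem p hp =>
    obtain ⟨l, m, rfl, rfl⟩ := hp
    refine ⟨Pi.single ⟨l, by omega⟩ 1, ?_, fun k => ?_⟩
    · unfold IsGVector
      rw [Finset.sum_eq_single_of_mem ⟨l, by omega⟩ (Finset.mem_univ _)]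
      · simp
      · intro k _ hk
        simp [hk]
    · by_cases hk : k = ⟨l, by omega⟩
      · subst hk; simp
      · simp [hk]
  | zero => exact ⟨0, by simp [IsGVector], fun _ => le_rfl⟩
  | add p q _ _ hp hq =>
    obtain ⟨g, hg, hg0⟩ := hp
    obtain ⟨g', hg', hg0'⟩ := hq
    refine ⟨g + g', ?_, fun l => add_nonneg (hg0 l) (hg0' l)⟩
    unfold IsGVector at *
    rw [hg, hg', ← Finset.sum_add_distrib]
    exact Finset.sum_congr rfl fun l _ => by simp [add_mul]

/-- Triangularity: t^l P_{d-2l,i} starts with t^l, with coefficient 1, so comparing coefficients of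
t^l determines the entries in order, over ℤ. -/
theorem IsGVector.unique {i d : ℕ} {p : ℤ[X]} {g g' : Fin (d / 2 + 1) → ℤ}
    (hg : IsGVector d i p g) (hg' : IsGVector d i p g') : g = g' := by
  unfold IsGVector at hg hg'
  funext l
  induction l using WellFoundedLT.induction with
  | ind l ih =>
    have h := congrArg (fun p : ℤ[X] => p.coeff (l : ℕ)) (hg.symm.trans hg')
    simp only [finsetSum_coeff, coeff_C_mul] at h
    rw [← Finset.add_sum_erase _ _ (Finset.mem_univ l),
      ← Finset.add_sum_erase _ _ (Finset.mem_univ l)] at h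
    have hrest : ∀ k ∈ Finset.univ.erase l,
        g k * (X ^ (k : ℕ) * gBasisP (d - 2 * (k : ℕ)) i).coeff (l : ℕ) =
        g' k * (X ^ (k : ℕ) * gBasisP (d - 2 * (k : ℕ)) i).coeff (l : ℕ) := by
      intro k hk
      rcases lt_or_gt_of_ne (Finset.ne_of_mem_erase hk) with hk | hk
      · rw [ih k hk]
      · rw [coeff_X_pow_mul', if_neg (by simpa using hk)]
        simp
    rw [Finset.sum_congr rfl hrest] at h
    have := add_right_cancel h
    simpa [coeff_X_pow_mul', gBasisP_coeff_zero] using this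

/-! ### Link `h`-polynomials under stellar subdivision. -/

/-- Expand ((1 - X) + X)^|S| = 1 over subsets, remove the term of ∅ and divide by 1 - X. -/
theorem sum_powerset_erase_empty {V : Type*} [DecidableEq V] (S : Finset V) :
    ∑ B ∈ S.powerset.erase ∅, (X : ℤ[X]) ^ (S.card - B.card) * (1 - X) ^ (B.card - 1) =
      geomPoly S.card := by
  apply mul_right_cancel₀ one_sub_X_ne_zero
  have h := Finset.sum_pow_mul_eq_add_pow (1 - X : ℤ[X]) X S
  rw [← Finset.add_sum_erase _ _ (Finset.empty_mem_powerset S)] at h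
  simp only [Finset.card_empty, pow_zero, one_mul, Nat.sub_zero, sub_add_cancel, one_pow] at h
  rw [geomPoly_mul, Finset.sum_mul, ← eq_sub_of_add_eq' h]
  refine Finset.sum_congr rfl fun B hB => ?_
  have hpos : 0 < B.card := Finset.card_pos.2
    (Finset.nonempty_iff_ne_empty.2 (Finset.ne_of_mem_erase hB))
  rw [mul_assoc, ← pow_succ, Nat.sub_add_cancel hpos, mul_comm]

namespace SimplComplex

theorem notMem_of_mem_faces {V : Type*} {K : SimplComplex V} {v : V} (hv : ¬ K.IsVertex v)
    {T : Finset V} (hT : T ∈ K.faces) : v ∉ T :=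
  fun h => hv (K.down_closed T hT {v} (by simpa using h))

variable {V : Type*} [DecidableEq V]

/-- The `h`-polynomial of the link of `ρ` in `K`, normalized so that facets of `K` have `d`
vertices. -/
noncomputable def linkH (K : SimplComplex V) (d : ℕ) (ρ : Finset V) : ℤ[X] :=
  ∑ T ∈ K.faces with ρ ⊆ T, X ^ (T \ ρ).card * (1 - X) ^ (d - T.card)

theorem hPoly_eq_linkH (K : SimplComplex V) : K.hPoly = K.linkH K.dimSucc ∅ := by
  have hle : ∀ T ∈ K.faces, T.card ≤ K.dimSucc := fun T hT => Finset.le_sup (f := Finset.card) hT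
  have hsum : K.linkH K.dimSucc ∅ = ∑ l ∈ Finset.range (K.dimSucc + 1),
      (K.fNum l : ℤ[X]) * (X ^ l * (1 - X) ^ (K.dimSucc - l)) := by
    unfold linkH
    simp only [Finset.empty_subset, Finset.filter_true, Finset.sdiff_empty]
    rw [← Finset.sum_fiberwise_of_maps_to (g := Finset.card) (t := Finset.range (K.dimSucc + 1))
      fun T hT => Finset.mem_range.2 (Nat.lt_succ_of_le (hle T hT))]
    refine Finset.sum_congr rfl fun l _ => ?_
    rw [Finset.sum_congr rfl (g := fun _ => X ^ l * (1 - X) ^ (K.dimSucc - l))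
      fun T hT => by rw [(Finset.mem_filter.1 hT).2]]
    simp [fNum]
  have hbin : ∀ l ∈ Finset.range (K.dimSucc + 1), (X : ℤ[X]) ^ l * (1 - X) ^ (K.dimSucc - l) =
      ∑ m ∈ Finset.range (K.dimSucc + 1), if l ≤ m then
        C ((-1 : ℤ) ^ (m - l) * (Nat.choose (K.dimSucc - l) (m - l) : ℤ)) * X ^ m else 0 := by
    intro l hl
    rw [← Finset.sum_filter]
    have hfil : (Finset.range (K.dimSucc + 1)).filter (fun m => l ≤ m) =
        Finset.Ico l (K.dimSucc + 1) := by
      ext m; simp [and_comm]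
    have hl' : K.dimSucc + 1 - l = K.dimSucc - l + 1 := by
      have := Finset.mem_range.1 hl; omega
    rw [hfil, Finset.sum_Ico_eq_sum_range, hl', sub_eq_neg_add, add_pow, Finset.mul_sum]
    refine Finset.sum_congr rfl fun k _ => ?_
    rw [Nat.add_sub_cancel_left, neg_pow (X : ℤ[X]) k]
    simp
    ring
  rw [hsum, Finset.sum_congr rfl fun l hl => by rw [hbin l hl, Finset.mul_sum],
    Finset.sum_comm]
  unfold hPoly hNum
  refine Finset.sum_congr rfl fun m hm => ?_
  have hm' : m < K.dimSucc + 1 := Finset.mem_range.1 hm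
  simp only [mul_ite, mul_zero]
  rw [← Finset.sum_filter, map_sum, Finset.sum_mul]
  have hfil : (Finset.range (K.dimSucc + 1)).filter (fun l => l ≤ m) = Finset.range (m + 1) := by
    ext l; simp; omega
  rw [hfil]
  refine Finset.sum_congr rfl fun l _ => ?_
  simp
  ring

/-- `K'` has the faces of the stellar subdivision of `K` at `F` with new vertex `v`. -/
def IsStellar (K K' : SimplComplex V) (F : Finset V) (v : V) : Prop :=
  ∀ T, T ∈ K'.faces ↔ ¬ F ⊆ T ∧ (T ∈ K.faces ∨ v ∈ T ∧ T.erase v ∪ F ∈ K.faces)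

section IsStellar

variable {K K' : SimplComplex V} {F : Finset V} {v : V}

theorem IsStellar.insert_sdiff_mem (h : IsStellar K K' F v) (hvF : v ∉ F) {G B : Finset V}
    (hG : G ∈ K.faces) (hFG : F ⊆ G) (hB : B ⊆ F) (hB0 : B.Nonempty) :
    insert v (G \ B) ∈ K'.faces := by
  refine (h _).2 ⟨fun hF => ?_, Or.inr ⟨Finset.mem_insert_self _ _, K.down_closed G hG _ ?_⟩⟩
  · obtain ⟨b, hb⟩ := hB0
    have := hF (hB hb)
    simp only [Finset.mem_insert, Finset.mem_sdiff, hb, not_true, and_false, or_false] at this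
    exact hvF (this ▸ hB hb)
  · refine Finset.union_subset (fun x hx => ?_) hFG
    simp only [Finset.mem_erase, Finset.mem_insert, Finset.mem_sdiff] at hx
    tauto

theorem IsStellar.card_le (h : IsStellar K K' F v) {d : ℕ}
    (hd : ∀ T ∈ K.faces, T.card ≤ d) : ∀ T ∈ K'.faces, T.card ≤ d := by
  intro T hT
  obtain ⟨hFT, hT | ⟨hvT, hT⟩⟩ := (h T).1 hT
  · exact hd T hT
  · obtain ⟨x, hxF, hxT⟩ := Finset.not_subset.1 hFT
    have hlt : (T.erase v).card < (T.erase v ∪ F).card :=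
      Finset.card_lt_card ⟨Finset.subset_union_left, fun hs =>
        hxT (Finset.mem_of_mem_erase (hs (Finset.mem_union_right _ hxF)))⟩
    have := hd _ hT
    have := Finset.card_erase_add_one hvT
    omega

theorem IsStellar.exists_card_eq (h : IsStellar K K' F v) (hv : ¬ K.IsVertex v) (hvF : v ∉ F)
    (hF : F.Nonempty) {d : ℕ} (hd : ∃ T ∈ K.faces, T.card = d) : ∃ T ∈ K'.faces, T.card = d := by
  obtain ⟨T, hT, rfl⟩ := hd
  by_cases hFT : F ⊆ T
  · obtain ⟨x, hx⟩ := hF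
    refine ⟨insert v (T \ {x}), h.insert_sdiff_mem hvF hT hFT (by simpa using hx) (by simp), ?_⟩
    have hvT := notMem_of_mem_faces hv hT
    rw [Finset.card_insert_of_notMem (by simp [hvT]), Finset.sdiff_singleton_eq_erase,
      Finset.card_erase_add_one (hFT hx)]
  · exact ⟨T, (h T).2 ⟨hFT, Or.inl hT⟩, rfl⟩

/-- Keeps every original vertex in use, so that later new vertices avoid all sets of original
vertices. Subdividing at a single vertex would delete it. -/
theorem IsStellar.isVertex (h : IsStellar K K' F v) (hF : 2 ≤ F.card) {u : V}
    (hu : K.IsVertex u) : K'.IsVertex u := by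
  refine (h _).2 ⟨fun hs => ?_, Or.inl hu⟩
  have := Finset.card_le_card hs
  simp at this
  omega

theorem linkH_eq_sum_not_subset_add (K : SimplComplex V) (d : ℕ) (ρ F : Finset V) :
    K.linkH d ρ = ∑ T ∈ K.faces with ρ ⊆ T ∧ ¬ F ⊆ T, X ^ (T \ ρ).card * (1 - X) ^ (d - T.card) +
      X ^ (F \ ρ).card * K.linkH d (ρ ∪ F) := by
  unfold linkH
  rw [← Finset.sum_filter_not_add_sum_filter _ (fun T => F ⊆ T), Finset.filter_filter,
    Finset.filter_filter, Finset.mul_sum]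
  congr 1
  have hfil : K.faces.filter (fun T => ρ ⊆ T ∧ F ⊆ T) = K.faces.filter (fun T => ρ ∪ F ⊆ T) := by
    simp only [Finset.union_subset_iff]
  rw [hfil]
  refine Finset.sum_congr rfl fun T hT => ?_
  have hT := Finset.union_subset_iff.1 (Finset.mem_filter.1 hT).2
  have hcard : (T \ ρ).card = (F \ ρ).card + (T \ (ρ ∪ F)).card := by
    rw [← Finset.card_union_of_disjoint]
    · congr 1; ext x
      have := @hT.2 x
      simp only [Finset.mem_union, Finset.mem_sdiff]; tauto
    · rw [Finset.disjoint_left]; intro x; simp only [Finset.mem_union, Finset.mem_sdiff]; tauto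
  rw [hcard, pow_add, mul_assoc]

/-- A new face is v together with G \ B, where G ⊇ ρ ∪ F is an old face and B ⊆ F \ ρ is the
nonempty set of missing vertices of F. The sum over B gives the geometric factor, the sum over G the
link polynomial. -/
theorem IsStellar.sum_new_faces (h : IsStellar K K' F v) (hv : ¬ K.IsVertex v) (hvF : v ∉ F)
    {d : ℕ} (hd : ∀ T ∈ K.faces, T.card ≤ d) {ρ : Finset V} (hvρ : v ∉ ρ) :
    ∑ T ∈ K'.faces with ρ ⊆ T ∧ v ∈ T, (X : ℤ[X]) ^ (T \ ρ).card * (1 - X) ^ (d - T.card) =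
      X * geomPoly (F \ ρ).card * K.linkH d (ρ ∪ F) := by
  have hprod : X * geomPoly (F \ ρ).card * K.linkH d (ρ ∪ F) =
      ∑ p ∈ (K.faces.filter fun T => ρ ∪ F ⊆ T) ×ˢ ((F \ ρ).powerset.erase ∅),
        (X * (X ^ ((F \ ρ).card - p.2.card) * (1 - X) ^ (p.2.card - 1))) *
          (X ^ (p.1 \ (ρ ∪ F)).card * (1 - X) ^ (d - p.1.card)) := by
    rw [← sum_powerset_erase_empty, linkH, Finset.sum_product, Finset.mul_sum]
    refine Finset.sum_congr rfl fun G _ => ?_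
    rw [Finset.mul_sum, Finset.sum_mul]
  rw [hprod]
  refine Finset.sum_nbij' (fun T => (T.erase v ∪ F, F \ T)) (fun p => insert v (p.1 \ p.2))
    ?_ ?_ ?_ ?_ ?_
  · intro T hT
    obtain ⟨hT, hρT, hvT⟩ := Finset.mem_filter.1 hT
    obtain ⟨hFT, hT | ⟨-, hT⟩⟩ := (h T).1 hT
    · exact absurd hvT (notMem_of_mem_faces hv hT)
    · simp only [Finset.mem_product, Finset.mem_filter, Finset.mem_erase, Finset.mem_powerset]
      refine ⟨⟨hT, Finset.union_subset_union_left (Finset.subset_erase.2 ⟨hρT, hvρ⟩)⟩, ?_,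
        Finset.sdiff_subset_sdiff le_rfl hρT⟩
      rwa [Ne, Finset.sdiff_eq_empty_iff_subset]
  · rintro ⟨G, B⟩ hp
    simp only [Finset.mem_product, Finset.mem_filter, Finset.mem_erase, Finset.mem_powerset,
      Finset.union_subset_iff] at hp
    obtain ⟨⟨hG, hρG, hFG⟩, hB0, hB⟩ := hp
    refine Finset.mem_filter.2 ⟨h.insert_sdiff_mem hvF hG hFG (hB.trans Finset.sdiff_subset)
      (Finset.nonempty_iff_ne_empty.2 hB0), fun x hx => ?_, Finset.mem_insert_self _ _⟩
    refine Finset.mem_insert_of_mem (Finset.mem_sdiff.2 ⟨hρG hx, fun hxB => ?_⟩)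
    exact (Finset.mem_sdiff.1 (hB hxB)).2 hx
  · intro T hT
    obtain ⟨hT, hρT, hvT⟩ := Finset.mem_filter.1 hT
    ext x
    by_cases hx : x = v
    · subst hx; simp [hvT]
    · simp only [Finset.mem_insert, Finset.mem_sdiff, Finset.mem_union, Finset.mem_erase]; tauto
  · rintro ⟨G, B⟩ hp
    simp only [Finset.mem_product, Finset.mem_filter, Finset.mem_erase, Finset.mem_powerset,
      Finset.union_subset_iff] at hp
    obtain ⟨⟨hG, hρG, hFG⟩, hB0, hB⟩ := hp
    have hvG := notMem_of_mem_faces hv hG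
    refine Prod.ext ?_ ?_
    · ext x
      have h1 := @hFG x
      have h2 := @hB x
      by_cases hx : x = v
      · subst hx; simp [hvG, hvF]
      · simp only [Finset.mem_insert, Finset.mem_sdiff, Finset.mem_union, Finset.mem_erase] at *
        tauto
    · ext x
      have h1 := @hFG x
      have h2 := @hB x
      by_cases hx : x = v
      · subst hx
        simp only [Finset.mem_insert, Finset.mem_sdiff] at *
        tauto
      · simp only [Finset.mem_insert, Finset.mem_sdiff] at *
        tauto
  · intro T hT
    obtain ⟨hT, hρT, hvT⟩ := Finset.mem_filter.1 hT
    obtain ⟨hFT, hT | ⟨-, hT⟩⟩ := (h T).1 hT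
    · exact absurd hvT (notMem_of_mem_faces hv hT)
    have hpos : 0 < (F \ T).card := Finset.card_pos.2 (Finset.sdiff_nonempty.2 hFT)
    have hle : (F \ T).card ≤ (F \ ρ).card :=
      Finset.card_le_card (Finset.sdiff_subset_sdiff le_rfl hρT)
    have hG : (T.erase v ∪ F).card + 1 = T.card + (F \ T).card := by
      have : T.erase v ∪ F = T.erase v ∪ F \ T := by
        ext x
        by_cases hx : x = v
        · subst hx; simp [hvF]
        · simp only [Finset.mem_sdiff, Finset.mem_union, Finset.mem_erase]; tauto
      rw [this, Finset.card_union_of_disjoint, add_right_comm, Finset.card_erase_add_one hvT]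
      exact Finset.disjoint_sdiff.mono_left (Finset.erase_subset _ _)
    have hdG := hd _ hT
    have hρF : (ρ ∪ F).card = ρ.card + (F \ ρ).card := by
      rw [← Finset.union_sdiff_self_eq_union, Finset.card_union_of_disjoint Finset.disjoint_sdiff]
    have hsub : ρ ∪ F ⊆ T.erase v ∪ F :=
      Finset.union_subset_union_left (Finset.subset_erase.2 ⟨hρT, hvρ⟩)
    have hle' := Finset.card_le_card hsub
    have hle'' := Finset.card_le_card hρT
    rw [Finset.card_sdiff_of_subset hρT, Finset.card_sdiff_of_subset hsub]
    have e1 : T.card - ρ.card =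
        1 + (((F \ ρ).card - (F \ T).card) + ((T.erase v ∪ F).card - (ρ ∪ F).card)) := by omega
    have e2 : d - T.card = ((F \ T).card - 1) + (d - (T.erase v ∪ F).card) := by omega
    rw [e1, e2]
    ring

/-- With k = |F \ ρ|, the lost faces contribute X^k and the new ones X [k], both times the
polynomial at ρ ∪ F; the difference is X [k-1]. -/
theorem IsStellar.linkH_eq (h : IsStellar K K' F v) (hv : ¬ K.IsVertex v) (hvF : v ∉ F)
    {d : ℕ} (hd : ∀ T ∈ K.faces, T.card ≤ d) {ρ : Finset V} (hvρ : v ∉ ρ) (hFρ : ¬ F ⊆ ρ) :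
    K'.linkH d ρ = K.linkH d ρ + X * geomPoly ((F \ ρ).card - 1) * K.linkH d (ρ ∪ F) := by
  have hpos : 0 < (F \ ρ).card := Finset.card_pos.2 (Finset.sdiff_nonempty.2 hFρ)
  obtain ⟨k, hk⟩ : ∃ k, (F \ ρ).card = k + 1 := ⟨_, (Nat.sub_add_cancel hpos).symm⟩
  have hnew := h.sum_new_faces hv hvF hd hvρ
  have hold := K.linkH_eq_sum_not_subset_add d ρ F
  have hfil : K'.faces.filter (fun T => ρ ⊆ T ∧ ¬ v ∈ T) =
      K.faces.filter (fun T => ρ ⊆ T ∧ ¬ F ⊆ T) := by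
    ext T
    have := @notMem_of_mem_faces V K v hv T
    simp only [Finset.mem_filter, h T]
    tauto
  rw [hold, linkH, ← Finset.sum_filter_not_add_sum_filter _ (fun T => v ∈ T), Finset.filter_filter,
    Finset.filter_filter, hnew, hfil, hk, Nat.add_sub_cancel]
  simp only [geomPoly, Finset.sum_range_succ, mul_add]
  ring

theorem linkH_eq_zero_of_notMem (d : ℕ) {ρ : Finset V} (hρ : ρ ∉ K.faces) : K.linkH d ρ = 0 := by
  refine Finset.sum_eq_zero fun T hT => ?_
  obtain ⟨hT, hρT⟩ := Finset.mem_filter.1 hT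
  exact absurd (K.down_closed T hT ρ hρT) hρ

theorem IsStellar.linkH_mem_gCone (h : IsStellar K K' F v) (hv : ¬ K.IsVertex v) (hvF : v ∉ F)
    {d i : ℕ} (hi : 1 ≤ i) (hFi : F.card ≤ i + 1) (hd : ∀ T ∈ K.faces, T.card ≤ d)
    {ρ : Finset V} (hvρ : v ∉ ρ) (hρ : K.linkH d ρ ∈ gCone i (d - ρ.card))
    (hρF : K.linkH d (ρ ∪ F) ∈ gCone i (d - (ρ ∪ F).card)) :
    K'.linkH d ρ ∈ gCone i (d - ρ.card) := by
  by_cases hFρ : F ⊆ ρ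
  · rw [linkH_eq_zero_of_notMem]
    · exact zero_mem _
    · exact fun hmem => ((h ρ).1 hmem).1 hFρ
  rw [h.linkH_eq hv hvF hd hvρ hFρ]
  refine add_mem hρ ?_
  by_cases hmem : ρ ∪ F ∈ K.faces
  · have hle := hd _ hmem
    have hcard : (ρ ∪ F).card = ρ.card + (F \ ρ).card := by
      rw [← Finset.union_sdiff_self_eq_union, Finset.card_union_of_disjoint Finset.disjoint_sdiff]
    have hk : (F \ ρ).card ≤ i + 1 := (Finset.card_le_card Finset.sdiff_subset).trans hFi
    rcases hs : (F \ ρ).card - 1 with _ | a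
    · simp
    -- Here |F \ ρ| = a + 2: the factor X adds 2 to the degree and [a+1] adds a, which makes up
    -- exactly for passing from ρ to ρ ∪ F.
    · have := X_pow_mul_mem_gCone 1 (geomPoly_mul_mem_gCone hi (a := a) (by omega) hρF)
      rw [pow_one, ← mul_assoc] at this
      convert this using 2
      omega
  · rw [linkH_eq_zero_of_notMem d hmem]
    simp

end IsStellar

end SimplComplex

/-! ### Replacement by a starred simplex as stellar subdivision. -/

namespace SimplComplex

theorem none_notMem_starredBoundary (j : ℕ) : none ∉ starredBoundary j := by
  simp [starredBoundary]

theorem some_mem_starredBoundary {j : ℕ} (a : Fin (j + 1)) : some a ∈ starredBoundary j := by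
  simp [starredBoundary]

theorem mem_starredSimplex_faces {j : ℕ} {ρ : Finset (Option (Fin (j + 1)))} :
    ρ ∈ (starredSimplex j).faces ↔ ¬ starredBoundary j ⊆ ρ := by
  simp only [starredSimplex, stellar, simplex, InLink, Finset.mem_union, Finset.mem_filter,
    Finset.mem_image, Finset.mem_product, Finset.mem_powerset, Finset.mem_ssubsets, Prod.exists]
  constructor
  · rintro (h | ⟨A, r, τ, ⟨hA, hr, hτ, -, hd, -⟩, rfl⟩) hB
    · exact h.2 hB
    · refine hr.2 fun x hx => ?_
      have := hB hx
      simp only [Finset.mem_union] at this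
      rcases this with h | h | h
      · exact absurd (Finset.mem_singleton.1 (hA h) ▸ hx) (none_notMem_starredBoundary j)
      · exact h
      · exact absurd h (Finset.disjoint_left.1 hd hx)
  · intro hB
    refine Or.inr ⟨ρ ∩ {none}, ρ ∩ starredBoundary j, ∅, ⟨Finset.inter_subset_right,
      ⟨Finset.inter_subset_right, fun h => hB (h.trans Finset.inter_subset_left)⟩, ?_⟩, ?_⟩
    · simp
    · ext x
      rcases x with _ | a
      · simp [none_notMem_starredBoundary]
      · simp [some_mem_starredBoundary]

theorem isVertex_starredSimplex {j : ℕ} (hj : 1 ≤ j) (w : Option (Fin (j + 1))) :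
    (starredSimplex j).IsVertex w := by
  refine mem_starredSimplex_faces.2 fun h => ?_
  have := Finset.card_le_card h
  simp [starredBoundary] at this
  omega

theorem IsReplacement.exists_isStellar {V : Type*} [DecidableEq V] {j : ℕ} (hj : 1 ≤ j)
    {σ : Finset V} {K K' : SimplComplex V}
    (h : IsReplacement (starredSimplex j) (starredBoundary j) σ K K') :
    ∃ v, ¬ K.IsVertex v ∧ v ∉ σ ∧ IsStellar K K' σ v := by
  obtain ⟨φ, hinj, rfl, hnew, hfaces⟩ := h
  -- For j ≥ 1 every name is a vertex of the starred simplex, so injectivity on vertices is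
  -- injectivity; for j = 0 the only boundary point is no longer a vertex.
  have hφ : Function.Injective φ := fun x y hxy =>
    hinj (isVertex_starredSimplex hj x) (isVertex_starredSimplex hj y) hxy
  have hmem : ∀ w, φ w ∈ (starredBoundary j).image φ ↔ w ∈ starredBoundary j := fun w =>
    hφ.mem_finset_image
  have hvσ : φ none ∉ (starredBoundary j).image φ := fun hv =>
    none_notMem_starredBoundary j ((hmem _).1 hv)
  refine ⟨φ none, hnew none (isVertex_starredSimplex hj none) (none_notMem_starredBoundary j),
    hvσ, fun T => (hfaces T).trans ⟨?_, ?_⟩⟩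
  · rintro (⟨hT, hσ⟩ | ⟨ρ, hρ, τ, ⟨hτ, hdisj, hu⟩, rfl⟩)
    · exact ⟨hσ, Or.inl hT⟩
    refine ⟨fun hs => mem_starredSimplex_faces.1 hρ fun w hw => ?_, ?_⟩
    · have hw' := (hmem w).2 hw
      rcases Finset.mem_union.1 (hs hw') with h | h
      · exact hφ.mem_finset_image.1 h
      · exact absurd h (Finset.disjoint_left.1 hdisj hw')
    · have hsub : (ρ.image φ ∪ τ).erase (φ none) ⊆ (starredBoundary j).image φ ∪ τ := by
        intro x hx
        obtain ⟨hx0, hx⟩ := Finset.mem_erase.1 hx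
        rcases Finset.mem_union.1 hx with hx | hx
        · obtain ⟨w, hw, rfl⟩ := Finset.mem_image.1 hx
          rcases w with _ | a
          · exact absurd rfl hx0
          · exact Finset.mem_union_left _ ((hmem _).2 (some_mem_starredBoundary a))
        · exact Finset.mem_union_right _ hx
      by_cases hv : φ none ∈ ρ.image φ ∪ τ
      · exact Or.inr ⟨hv, K.down_closed _ hu _
          (Finset.union_subset hsub Finset.subset_union_left)⟩
      · rw [Finset.erase_eq_of_notMem hv] at hsub
        exact Or.inl (K.down_closed _ hu _ hsub)
  · rintro ⟨hσ, hT | ⟨hvT, hT⟩⟩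
    · exact Or.inl ⟨hT, hσ⟩
    -- T is split into its part in the image of φ, pulled back, and the rest, which lies in the link
    -- of σ.
    refine Or.inr ⟨Finset.univ.filter (fun w => φ w ∈ T), mem_starredSimplex_faces.2 fun hB => ?_,
      T.erase (φ none) \ (starredBoundary j).image φ, ⟨?_, Finset.disjoint_sdiff, ?_⟩, ?_⟩
    · exact hσ (Finset.image_subset_iff.2 fun w hw => (Finset.mem_filter.1 (hB hw)).2)
    · exact K.down_closed _ hT _ (Finset.sdiff_subset.trans Finset.subset_union_left)
    · rwa [Finset.union_sdiff_self_eq_union, Finset.union_comm]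
    · ext x
      simp only [Finset.mem_union, Finset.mem_sdiff, Finset.mem_erase]
      constructor
      · intro hx
        by_cases hx' : ∃ w, φ w = x
        · obtain ⟨w, rfl⟩ := hx'
          exact Or.inl (Finset.mem_image_of_mem _ (by simpa using hx))
        · refine Or.inr ⟨⟨fun h => hx' ⟨none, h.symm⟩, hx⟩, fun h => ?_⟩
          obtain ⟨w, -, hw⟩ := Finset.mem_image.1 h
          exact hx' ⟨w, hw⟩
      · rintro (hx | hx)
        · obtain ⟨w, hw, rfl⟩ := Finset.mem_image.1 hx
          exact (Finset.mem_filter.1 hw).2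
        · exact hx.1.2

/-! ### Links in the cross-polytope. -/

/-- The signs `b` for which `(a, b)` belongs to `T`. -/
def signsAt {d : ℕ} (T : Finset (Fin d × Bool)) (a : Fin d) : Finset Bool :=
  Finset.univ.filter fun b => (a, b) ∈ T

@[simp] theorem mem_signsAt {d : ℕ} {T : Finset (Fin d × Bool)} {a : Fin d} {b : Bool} :
    b ∈ signsAt T a ↔ (a, b) ∈ T := by simp [signsAt]

theorem sum_card_signsAt {d : ℕ} (T : Finset (Fin d × Bool)) :
    ∑ a, (signsAt T a).card = T.card := by
  simp only [signsAt, Finset.card_filter]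
  rw [← Fintype.sum_prod_type (f := fun p : Fin d × Bool => if p ∈ T then 1 else 0)]
  simp

theorem mem_crossPolytope_faces {d : ℕ} {T : Finset (Fin d × Bool)} :
    T ∈ (crossPolytope d).faces ↔ ∀ a, (signsAt T a).card ≤ 1 := by
  simp only [crossPolytope, Finset.mem_filter, Finset.mem_univ, true_and]
  refine forall_congr' fun a => ?_
  rw [Finset.card_le_one]
  simp only [mem_signsAt, Bool.forall_bool, reduceCtorEq, imp_false, implies_true, true_and,
    and_true]
  tauto

theorem card_le_of_mem_crossPolytope {d : ℕ} {T : Finset (Fin d × Bool)}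
    (hT : T ∈ (crossPolytope d).faces) : T.card ≤ d := by
  rw [← sum_card_signsAt T]
  refine (Finset.sum_le_sum fun a _ => mem_crossPolytope_faces.1 hT a).trans ?_
  simp

theorem sum_sub_card_signsAt {d : ℕ} {T : Finset (Fin d × Bool)}
    (hT : T ∈ (crossPolytope d).faces) : ∑ a, (1 - (signsAt T a).card) = d - T.card := by
  rw [Finset.sum_tsub_distrib _ fun a _ => mem_crossPolytope_faces.1 hT a, sum_card_signsAt]
  simp

theorem sum_signs_eq {r : Finset Bool} (hr : r.card ≤ 1) :
    ∑ s : Finset Bool with s.card ≤ 1 ∧ r ⊆ s, (X : ℤ[X]) ^ (s \ r).card * (1 - X) ^ (1 - s.card) =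
      (1 + X) ^ (1 - r.card) := by
  have h : r = ∅ ∨ r = {true} ∨ r = {false} := by revert r; decide
  rcases h with rfl | rfl | rfl
  · have : (Finset.univ.filter fun s : Finset Bool => s.card ≤ 1 ∧ ∅ ⊆ s) =
        {∅, {true}, {false}} := by decide
    rw [this, Finset.sum_insert (by decide), Finset.sum_insert (by decide), Finset.sum_singleton]
    simp
  · have : (Finset.univ.filter fun s : Finset Bool => s.card ≤ 1 ∧ {true} ⊆ s) =
        {{true}} := by decide
    rw [this]
    simp
  · have : (Finset.univ.filter fun s : Finset Bool => s.card ≤ 1 ∧ {false} ⊆ s) =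
        {{false}} := by decide
    rw [this]
    simp

/-- The complex is the join of d pairs of points, so the sum factors over coordinates: 1 + X where ρ
has no vertex, 1 where it has one. -/
theorem linkH_crossPolytope {d : ℕ} {ρ : Finset (Fin d × Bool)}
    (hρ : ρ ∈ (crossPolytope d).faces) :
    (crossPolytope d).linkH d ρ = (1 + X) ^ (d - ρ.card) := by
  rw [← sum_sub_card_signsAt hρ, ← Finset.prod_pow_eq_pow_sum,
    Finset.prod_congr rfl fun a _ => (sum_signs_eq (mem_crossPolytope_faces.1 hρ a)).symm,
    Finset.prod_univ_sum, linkH]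
  refine Finset.sum_nbij' signsAt (fun f => Finset.univ.filter fun p => p.2 ∈ f p.1) ?_ ?_ ?_ ?_ ?_
  · intro T hT
    obtain ⟨hT, hρT⟩ := Finset.mem_filter.1 hT
    refine Fintype.mem_piFinset.2 fun a => Finset.mem_filter.2 ⟨Finset.mem_univ _,
      mem_crossPolytope_faces.1 hT a, fun b hb => ?_⟩
    exact mem_signsAt.2 (hρT (mem_signsAt.1 hb))
  · intro f hf
    have hf' : ∀ a, (f a).card ≤ 1 ∧ signsAt ρ a ⊆ f a := fun a =>
      (Finset.mem_filter.1 (Fintype.mem_piFinset.1 hf a)).2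
    refine Finset.mem_filter.2 ⟨mem_crossPolytope_faces.2 fun a => ?_, fun p hp => ?_⟩
    · convert (hf' a).1
      ext b; simp
    · simpa using (hf' p.1).2 (mem_signsAt.2 hp)
  · intro T _
    ext p; simp
  · intro f _
    funext a; ext b; simp
  · intro T hT
    have hT := (Finset.mem_filter.1 hT).1
    rw [Finset.prod_mul_distrib, Finset.prod_pow_eq_pow_sum, Finset.prod_pow_eq_pow_sum,
      sum_sub_card_signsAt hT, ← sum_card_signsAt (T \ ρ)]
    congr 2
    refine Finset.sum_congr rfl fun a _ => congrArg _ ?_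
    ext b; simp

theorem linkH_map {V W : Type*} [DecidableEq V] [DecidableEq W] (e : V ↪ W) (K : SimplComplex V)
    (d : ℕ) (ρ : Finset V) : (K.map e).linkH d (ρ.map e) = K.linkH d ρ := by
  unfold linkH map
  rw [Finset.filter_image, Finset.sum_image fun _ _ _ _ h => Finset.map_injective e h]
  simp only [Finset.map_subset_map, ← Finset.map_sdiff, Finset.card_map]

theorem linkH_map_crossPolytope_mem_gCone {V : Type*} [DecidableEq V] {d i : ℕ} (hi : 1 ≤ i)
    (e : Fin d × Bool ↪ V) (ρ : Finset V) :
    ((crossPolytope d).map e).linkH d ρ ∈ gCone i (d - ρ.card) := by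
  by_cases hρ : ρ ∈ ((crossPolytope d).map e).faces
  · obtain ⟨ρ, hρ', rfl⟩ := Finset.mem_image.1 hρ
    rw [linkH_map, linkH_crossPolytope hρ', Finset.card_map]
    exact one_add_X_pow_mem_gCone hi _
  · rw [linkH_eq_zero_of_notMem d hρ]
    exact zero_mem _

theorem exists_card_eq_crossPolytope (d : ℕ) : ∃ T ∈ (crossPolytope d).faces, T.card = d :=
  ⟨Finset.univ.image fun a => (a, true), by simp [crossPolytope], by
    rw [Finset.card_image_of_injective _ fun _ _ h => (Prod.ext_iff.1 h).1, Finset.card_fin]⟩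

/-! ### Induction along the subdivisions. -/

theorem IsGenTchebyshev.hPoly_mem_gCone {V : Type*} [DecidableEq V] {d i j : ℕ} (hj : 1 ≤ j)
    (hji : j ≤ i) {e : Fin d × Bool ↪ V} {K' : SimplComplex V}
    (h : IsGenTchebyshev j (starredSimplex j) (starredBoundary j) ((crossPolytope d).map e) K') :
    K'.hPoly ∈ gCone i d := by
  obtain ⟨m, σ, Ks, -, hσ, h0, rfl, hstep⟩ := h
  have hσ' : ∀ a, σ a ∈ (Ks 0).faces ∧ (σ a).card = j + 1 := fun a => h0 ▸ (hσ _).1 ⟨a, rfl⟩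
  -- Only sets ρ of original vertices are tracked: they avoid each new vertex, and they are closed
  -- under ρ ↦ ρ ∪ σ_a because every σ_a is a face of the original complex. Neither ρ nor ρ ∪ σ_a
  -- need be a face, as the polynomial is then 0. The first two clauses keep the dimension fixed, so
  -- that d is the right normalization at the end.
  have key : ∀ b : Fin (m + 1), (∀ T ∈ (Ks b).faces, T.card ≤ d) ∧
      (∃ T ∈ (Ks b).faces, T.card = d) ∧ (∀ u, (Ks 0).IsVertex u → (Ks b).IsVertex u) ∧
      ∀ ρ : Finset V, (∀ u ∈ ρ, (Ks 0).IsVertex u) →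
        (Ks b).linkH d ρ ∈ gCone i (d - ρ.card) := by
    intro b
    induction b using Fin.induction with
    | zero =>
      refine ⟨fun T hT => ?_, ?_, fun u hu => hu, fun ρ _ => ?_⟩
      · rw [h0] at hT
        obtain ⟨T, hT', rfl⟩ := Finset.mem_image.1 hT
        rw [Finset.card_map]
        exact card_le_of_mem_crossPolytope hT'
      · obtain ⟨T, hT, hc⟩ := exists_card_eq_crossPolytope d
        exact ⟨T.map e, h0 ▸ Finset.mem_image_of_mem _ hT, by rw [Finset.card_map, hc]⟩
      · rw [h0]
        exact linkH_map_crossPolytope_mem_gCone (hj.trans hji) e ρ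
    | succ a ih =>
      obtain ⟨hle, hex, hvert, hcone⟩ := ih
      obtain ⟨v, hv, hvσ, hst⟩ := (hstep a).exists_isStellar hj
      obtain ⟨hσK, hσc⟩ := hσ' a
      refine ⟨hst.card_le hle, hst.exists_card_eq hv hvσ (Finset.card_pos.1 (by omega)) hex,
        fun u hu => hst.isVertex (by omega) (hvert u hu), fun ρ hρ => ?_⟩
      refine hst.linkH_mem_gCone hv hvσ (hj.trans hji) (by omega) hle
        (fun hvρ => hv (hvert v (hρ v hvρ))) (hcone ρ hρ) (hcone _ fun u hu => ?_)
      rcases Finset.mem_union.1 hu with hu | hu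
      · exact hρ u hu
      · exact (Ks 0).down_closed _ hσK _ (by simpa using hu)
  obtain ⟨hle, ⟨T, hT, hc⟩, -, hcone⟩ := key (Fin.last m)
  have hdim : (Ks (Fin.last m)).dimSucc = d :=
    le_antisymm (Finset.sup_le hle) (hc ▸ Finset.le_sup (f := Finset.card) hT)
  rw [hPoly_eq_linkH, hdim]
  simpa using hcone ∅ (by simp)

end SimplComplex

theorem mainTheorem9 {V : Type*} [DecidableEq V] (d i j : ℕ) (hd : 1 ≤ d)
    (hj : 1 ≤ j) (hji : j ≤ i) (e : Fin d × Bool ↪ V) (K' : SimplComplex V)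
    (hK' : SimplComplex.IsGenTchebyshev j (SimplComplex.starredSimplex j)
      (SimplComplex.starredBoundary j) ((SimplComplex.crossPolytope d).map e) K') :
    (∃! g : Fin (d / 2 + 1) → ℤ, IsGVector d i K'.hPoly g) ∧
      ∀ g : Fin (d / 2 + 1) → ℤ, IsGVector d i K'.hPoly g → ∀ l, 0 ≤ g l := by
  obtain ⟨g, hg, hg0⟩ := exists_nonneg_isGVector (hK'.hPoly_mem_gCone hj hji)
  exact ⟨⟨g, hg, fun g' hg' => hg'.unique hg⟩, fun g' hg' => hg'.unique hg ▸ hg0⟩
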